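/- Let $p,q,k\ge 1$ be integers with $\gcd(p,q)=1$, let $G=\langle a,b\mid a^p=b^q\rangle$ be the $(p,q)$-torus knot group, and for a group element $g$ and an integer $m\ge 0$ write $N_g^m=1+g+\cdots+g^m$ in the integral group ring. Then $a^{kp}$ is a nontrivial central element of $G$. Put $\Gamma_k=G/\langle a^{kp}\rangle$ and let $S,U\in\Gamma_k$ be the images of $a,b$. (1) There are isomorphisms $$\Gamma_k\;\cong\;\langle S,U\mid S^{kp}=U^{kq}=1,\ S^p=U^q\rangle\;\cong\;\mathbb{Z}/kp *_{\mathbb{Z}/k}\mathbb{Z}/kq,$$ where $S$ and $U$ correspond to the generators of the same name and to the standard generators of $\mathbb{Z}/kp$ and $\mathbb{Z}/kq$, and where $\mathbb{Z}/k$ is embedded in the two factors by multiplication by $p$ and by $q$ respectively. (2) Let maps $\mathbb{Z}\Gamma_k^{m}\to\mathbb{Z}\Gamma_k^{n}$ of free left modules be given by $m\times n$ matrices acting on the right of row vectors. Then the trivial left module $\mathbb{Z}$ has the free resolution $$\cdots\xrightarrow{\partial_2}\mathbb{Z}\Gamma_k^2\xrightarrow{\partial_3}\mathbb{Z}\Gamma_k^2\xrightarrow{\partial_2}\mathbb{Z}\Gamma_k^2\xrightarrow{\partial_1}\mathbb{Z}\Gamma_k\xrightarrow{\varepsilon}\mathbb{Z}\to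 0,$$ where $\varepsilon$ is the augmentation and $$\partial_1=\begin{bmatrix}S-1\\ U-1\end{bmatrix},\qquad \partial_2=\begin{bmatrix}N_S^{kp-1}&0\\ N_S^{p-1}&-N_U^{q-1}\end{bmatrix},\qquad \partial_3=\begin{bmatrix}S-1&0\\ U-1&(1-U)\,N_{U^q}^{k-1}\end{bmatrix}.$$ That is, the sequence is exact, with differential $\partial_1$ from degree $1$ to degree $0$, $\partial_2$ out of every even degree $\ge 2$, and $\partial_3$ out of every odd degree $\ge 3$. (3) In degrees $\ge 1$ this resolution is $2$-periodic, with stable rank $2$: every module in degree $\ge 1$ is $\mathbb{Z}\Gamma_k^2$, and each of its bases has exactly $2$ elements. -/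

import Mathlib

namespace TorusKnot

/-! ## The groups -/

/-- The `(p,q)`-torus knot group, the one-relator group `⟨a, b ∣ a ^ p = b ^ q⟩`
(`a` is the generator `0`, `b` is the generator `1`). -/
abbrev KnotGroup (p q : ℕ) : Type :=
  PresentedGroup
    ({FreeGroup.of 0 ^ p * (FreeGroup.of 1 ^ q)⁻¹} : Set (FreeGroup (Fin 2)))

/-- The generator `a` of the torus knot group. -/
def a (p q : ℕ) : KnotGroup p q := PresentedGroup.of 0

/-- The generator `b` of the torus knot group. -/
def b (p q : ℕ) : KnotGroup p q := PresentedGroup.of 1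

theorem a_pow_eq (p q : ℕ) : a p q ^ p = b p q ^ q := by
  have h : PresentedGroup.mk
      ({FreeGroup.of 0 ^ p * (FreeGroup.of 1 ^ q)⁻¹} : Set (FreeGroup (Fin 2)))
      (FreeGroup.of 0 ^ p) = PresentedGroup.mk _ (FreeGroup.of 1 ^ q) :=
    PresentedGroup.mk_eq_mk_of_mul_inv_mem (Set.mem_singleton _)
  rw [map_pow, map_pow] at h
  exact h

theorem a_pow_mem_center (p q k : ℕ) :
    a p q ^ (k * p) ∈ Subgroup.center (KnotGroup p q) := by
  rw [Subgroup.mem_center_iff]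
  intro g
  have hb : a p q ^ (k * p) = b p q ^ (q * k) := by
    rw [mul_comm, pow_mul, a_pow_eq, ← pow_mul]
  have hg : g ∈ Subgroup.centralizer ({a p q ^ (k * p)} : Set (KnotGroup p q)) := by
    refine PresentedGroup.generated_by _ _ (fun j => ?_) g
    rw [Subgroup.mem_centralizer_singleton_iff]
    fin_cases j
    · exact (Commute.pow_self (a p q) (k * p)).symm
    · rw [hb]
      exact (Commute.pow_self (b p q) (q * k)).symm
  exact Subgroup.mem_centralizer_singleton_iff.mp hg

/-- The cyclic subgroup `⟨a ^ (k p)⟩` of the torus knot group. -/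
def centralSubgroup (p q k : ℕ) : Subgroup (KnotGroup p q) :=
  Subgroup.zpowers (a p q ^ (k * p))

instance centralSubgroup_normal (p q k : ℕ) : (centralSubgroup p q k).Normal :=
  ⟨fun n hn g => by
    have h : n ∈ Subgroup.center (KnotGroup p q) :=
      Subgroup.zpowers_le.mpr (a_pow_mem_center p q k) hn
    rw [Subgroup.mem_center_iff.mp h g, mul_inv_cancel_right]
    exact hn⟩

/-- The quotient `Γ_k = G / ⟨a ^ (k p)⟩` of the torus knot group `G`. -/
abbrev Gam (p q k : ℕ) : Type := KnotGroup p q ⧸ centralSubgroup p q k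

/-- The image `S` of `a` in `Γ_k`. -/
def S (p q k : ℕ) : Gam p q k := QuotientGroup.mk (a p q)

/-- The image `U` of `b` in `Γ_k`. -/
def U (p q k : ℕ) : Gam p q k := QuotientGroup.mk (b p q)

/-- The group `⟨S, U ∣ S ^ (k p) = U ^ (k q) = 1, S ^ p = U ^ q⟩`
(`S` is the generator `0`, `U` is the generator `1`). -/
abbrev Presented (p q k : ℕ) : Type :=
  PresentedGroup
    ({FreeGroup.of 0 ^ (k * p), FreeGroup.of 1 ^ (k * q),
      FreeGroup.of 0 ^ p * (FreeGroup.of 1 ^ q)⁻¹} : Set (FreeGroup (Fin 2)))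

/-- The homomorphism `ℤ/k → ℤ/kn`, `x ↦ n x`, written multiplicatively. -/
def cyclicInclusion (k n : ℕ) :
    Multiplicative (ZMod k) →* Multiplicative (ZMod (k * n)) :=
  AddMonoidHom.toMultiplicative
    (ZMod.lift k ⟨zmultiplesHom (ZMod (k * n)) (n : ZMod (k * n)), by
      simp only [zmultiplesHom_apply, natCast_zsmul, nsmul_eq_mul]
      exact_mod_cast ZMod.natCast_self (k * n)⟩)

/-- It sends the generator of `ℤ/k` to the `n`-th power of the generator of `ℤ/kn`. -/
theorem cyclicInclusion_gen (k n : ℕ) :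
    cyclicInclusion k n (Multiplicative.ofAdd 1) = Multiplicative.ofAdd 1 ^ n := by
  have h := ZMod.lift_coe k ⟨zmultiplesHom (ZMod (k * n)) (n : ZMod (k * n)), by
      simp only [zmultiplesHom_apply, natCast_zsmul, nsmul_eq_mul]
      exact_mod_cast ZMod.natCast_self (k * n)⟩ 1
  rw [← ofAdd_nsmul, nsmul_one]
  simpa [cyclicInclusion] using h

/-- The homomorphism `ℤ/k → ℤ/kn` is an inclusion. -/
theorem cyclicInclusion_injective (k n : ℕ) (hn : 0 < n) :
    Function.Injective (cyclicInclusion k n) := by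
  suffices h : Function.Injective
      (ZMod.lift k ⟨zmultiplesHom (ZMod (k * n)) (n : ZMod (k * n)), by
        simp only [zmultiplesHom_apply, natCast_zsmul, nsmul_eq_mul]
        exact_mod_cast ZMod.natCast_self (k * n)⟩) from h
  rw [ZMod.lift_injective]
  intro m hm
  have hm' : ((m * n : ℤ) : ZMod (k * n)) = 0 := by
    simpa [zmultiplesHom_apply] using hm
  rw [ZMod.intCast_zmod_eq_zero_iff_dvd] at hm'
  rw [ZMod.intCast_zmod_eq_zero_iff_dvd]
  push_cast at hm'
  exact Int.dvd_of_mul_dvd_mul_right (by exact_mod_cast hn.ne') hm'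

/-- The amalgamated free product `ℤ/kp *_{ℤ/k} ℤ/kq`: the pushout of the inclusions of `ℤ/k` in
`ℤ/kp` (factor `0`) and in `ℤ/kq` (factor `1`). -/
abbrev Amalgam (p q k : ℕ) : Type :=
  Monoid.PushoutI (H := Multiplicative (ZMod k))
    (G := fun i : Fin 2 => Multiplicative (ZMod (k * (![p, q] i))))
    (fun i => cyclicInclusion k (![p, q] i))

/-! ## Resolutions by finitely generated free modules -/

section Resolution

variable {A : Type} [Ring A]

/-- The map of left modules `A ^ m → A ^ n`, `x ↦ x * D`, on row vectors. -/
abbrev rowMap {m n : ℕ} (D : Matrix (Fin m) (Fin n) A) : (Fin m → A) →ₗ[A] (Fin n → A) :=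
  Matrix.toLinearMapRight' D

/-- The sequence `⋯ → A ^ (r 2) → A ^ (r 1) → A ^ (r 0) → M → 0` is exact, where the
differential from degree `n + 1` to degree `n` is given by the matrix `D n` and the last map
is `ε`. -/
structure IsFreeResolution {M : Type} [AddCommGroup M] [Module A M] (r : ℕ → ℕ)
    (D : ∀ n, Matrix (Fin (r (n + 1))) (Fin (r n)) A) (ε : (Fin (r 0) → A) →ₗ[A] M) :
    Prop where
  surjective : Function.Surjective ε
  exact_zero : Function.Exact (rowMap (D 0)) ε
  exact_succ : ∀ n, Function.Exact (rowMap (D (n + 1))) (rowMap (D n))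

/-- In degrees `≥ m` the modules, and the differentials between them, repeat with period `2`. -/
def IsTwoPeriodicFrom (m : ℕ) (r : ℕ → ℕ) (D : ∀ n, Matrix (Fin (r (n + 1))) (Fin (r n)) A) :
    Prop :=
  ∀ n, m ≤ n → ∃ (h₀ : r (n + 2) = r n) (h₁ : r (n + 3) = r (n + 1)),
    D (n + 2) = (D n).submatrix (Fin.cast h₁) (Fin.cast h₀)

/-- In degrees `≥ m` every basis of the module `A ^ (r n)` has exactly `s` elements. -/
def HasStableRankFrom (A : Type) [Ring A] (m : ℕ) (r : ℕ → ℕ) (s : ℕ) : Prop :=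
  ∀ n, m ≤ n → r n = s ∧
    ∀ (ι : Type), Module.Basis ι A (Fin (r n) → A) → Nat.card ι = s

end Resolution

/-! ## The integral group ring, the trivial module, and the explicit differentials -/

section GroupRing

variable {Γ : Type} [Group Γ]

/-- The trivial module `ℤ` over the integral group ring. -/
abbrev TrivialModule (Γ : Type) [Group Γ] : Type :=
  (Representation.trivial ℤ Γ ℤ).asModule

/-- The augmentation `ε : ℤΓ → ℤ`, `x ↦ x • 1`, as a map of `ℤΓ`-modules. -/
noncomputable def augmentation (Γ : Type) [Group Γ] :
    MonoidAlgebra ℤ Γ →ₗ[MonoidAlgebra ℤ Γ] TrivialModule Γ :=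
  LinearMap.toSpanSingleton (MonoidAlgebra ℤ Γ) (TrivialModule Γ)
    ((Representation.trivial ℤ Γ ℤ).asModuleEquiv.symm 1)

theorem augmentation_single (g : Γ) (n : ℤ) :
    (Representation.trivial ℤ Γ ℤ).asModuleEquiv
      (augmentation Γ (MonoidAlgebra.single g n)) = n := by
  simp only [augmentation, LinearMap.toSpanSingleton_apply, Representation.asModuleEquiv_map_smul,
    Representation.asAlgebraHom_single]
  simp

/-- The augmentation on the free module of row vectors of length one. -/
noncomputable def augmentationRow (Γ : Type) [Group Γ] :
    (Fin 1 → MonoidAlgebra ℤ Γ) →ₗ[MonoidAlgebra ℤ Γ] TrivialModule Γ :=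
  augmentation Γ ∘ₗ LinearMap.proj 0

/-- A group element as an element of the group ring. -/
noncomputable abbrev el (g : Γ) : MonoidAlgebra ℤ Γ := MonoidAlgebra.of ℤ Γ g

/-- `normSum g m = 1 + g + ⋯ + g ^ m` in the group ring. -/
noncomputable def normSum (g : Γ) (m : ℕ) : MonoidAlgebra ℤ Γ :=
  ∑ i ∈ Finset.range (m + 1), el (g ^ i)

end GroupRing

/-- The integral group ring of `Γ_k`. -/
abbrev GroupRing (p q k : ℕ) : Type := MonoidAlgebra ℤ (Gam p q k)

/-- The differential `∂₁`. -/
noncomputable def del1 (p q k : ℕ) : Matrix (Fin 2) (Fin 1) (GroupRing p q k) :=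
  !![el (S p q k) - 1;
     el (U p q k) - 1]

/-- The differential `∂₂`. -/
noncomputable def del2 (p q k : ℕ) : Matrix (Fin 2) (Fin 2) (GroupRing p q k) :=
  !![normSum (S p q k) (k * p - 1), 0;
     normSum (S p q k) (p - 1), -normSum (U p q k) (q - 1)]

/-- The differential `∂₃`. -/
noncomputable def del3 (p q k : ℕ) : Matrix (Fin 2) (Fin 2) (GroupRing p q k) :=
  !![el (S p q k) - 1, 0;
     el (U p q k) - 1, (1 - el (U p q k)) * normSum (U p q k ^ q) (k - 1)]

/-- The number of free generators in each degree: `1` in degree `0` and `2` in degrees `≥ 1`. -/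
def freeRank : ℕ → ℕ
  | 0 => 1
  | _ + 1 => 2

/-- The differentials `∂₁, ∂₂, ∂₃, ∂₂, ∂₃, …`; the matrix with index `n` is the differential from
degree `n + 1` to degree `n`. -/
noncomputable def differential (p q k : ℕ) :
    ∀ n, Matrix (Fin (freeRank (n + 1))) (Fin (freeRank n)) (GroupRing p q k)
  | 0 => del1 p q k
  | n + 1 => if Even n then del2 p q k else del3 p q k

end TorusKnot

/-! A homomorphism out of `Γ_k` is a pair `s, u` with `s ^ p = u ^ q` and `s ^ (k p) = 1`. The
presentation and the pushout have the same universal property, so both isomorphisms are formal. The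
assignment `a ↦ q`, `b ↦ p`, into `ℤ` and into `ℤ/kpq`, shows that `a ^ (k p)` is nontrivial and
that `S` and `U` have exact orders `k p` and `k q`.

For the resolution, write `N` for the norm `1 + h + ⋯ + h ^ (n - 1)` of an element `h` of order `n`.
The group ring is free as a right module over `ℤ⟨h⟩`, so right multiplications by `h - 1` and by `N`
have each other's image as kernel (`exists_eq_mul_sub_one`, `exists_eq_mul_geom_sum`).

Exactness in degree 0 says that `S - 1` and `U - 1` generate the augmentation ideal. Degree 1 is
where the amalgam enters: a relation `x (S - 1) + y (U - 1) = 0` forces the common value `x (S - 1)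
= -y (U - 1)` to be a left multiple of `S ^ p - 1 = U ^ q - 1` (`exists_mul_S_sub_one_eq`). This is
detected by a crossed homomorphism that vanishes at `U`. Once such a multiple is split off, the two
remainders are killed by `S - 1` and by `U - 1`, and the cyclic lemmas finish. The higher degrees
follow from these facts together with the factorization of norms `geom_sum_mul_geom_sum`.

Bases have a well-defined size because the group ring maps to `ℤ`. -/

namespace TorusKnot

/-! ### Universal properties of the groups and the orders of `S` and `U` -/

section GroupHoms

variable {p q k : ℕ} {H : Type*} [Group H]

/-- The homomorphism from the torus knot group given by a solution of `s ^ p = u ^ q`. -/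
def knotLift (s u : H) (h : s ^ p = u ^ q) : KnotGroup p q →* H :=
  PresentedGroup.toGroup (f := ![s, u]) (by
    rintro r rfl
    simp [h])

@[simp]
theorem knotLift_a (s u : H) (h : s ^ p = u ^ q) : knotLift s u h (a p q) = s :=
  PresentedGroup.toGroup.of _

@[simp]
theorem knotLift_b (s u : H) (h : s ^ p = u ^ q) : knotLift s u h (b p q) = u :=
  PresentedGroup.toGroup.of _

/-- The homomorphism from `Γ_k` given by a solution of `s ^ p = u ^ q`, `s ^ (k p) = 1`. -/
def gamLift (s u : H) (h : s ^ p = u ^ q) (hk : s ^ (k * p) = 1) : Gam p q k →* H :=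
  QuotientGroup.lift _ (knotLift s u h) (by
    rw [centralSubgroup, Subgroup.zpowers_le, MonoidHom.mem_ker, map_pow, knotLift_a, hk])

@[simp]
theorem gamLift_S (s u : H) (h : s ^ p = u ^ q) (hk : s ^ (k * p) = 1) :
    gamLift s u h hk (S p q k) = s :=
  knotLift_a s u h

@[simp]
theorem gamLift_U (s u : H) (h : s ^ p = u ^ q) (hk : s ^ (k * p) = 1) :
    gamLift s u h hk (U p q k) = u :=
  knotLift_b s u h

theorem S_pow_eq (p q k : ℕ) : S p q k ^ p = U p q k ^ q := by
  rw [S, U, ← QuotientGroup.mk_pow, ← QuotientGroup.mk_pow, a_pow_eq]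

theorem S_pow_mul (p q k : ℕ) : S p q k ^ (k * p) = 1 := by
  rw [S, ← QuotientGroup.mk_pow, QuotientGroup.eq_one_iff]
  exact Subgroup.mem_zpowers _

theorem U_pow_mul (p q k : ℕ) : U p q k ^ (k * q) = 1 := by
  rw [mul_comm, pow_mul, ← S_pow_eq, ← pow_mul, mul_comm, S_pow_mul]

theorem eq_top_of_S_U_mem {K : Subgroup (Gam p q k)} (hS : S p q k ∈ K) (hU : U p q k ∈ K) :
    K = ⊤ := by
  rw [eq_top_iff]
  rintro g -
  obtain ⟨g, rfl⟩ := QuotientGroup.mk_surjective g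
  refine PresentedGroup.generated_by _
    (K.comap (QuotientGroup.mk' (centralSubgroup p q k))) (fun j => ?_) g
  fin_cases j
  · exact hS
  · exact hU

theorem gam_hom_ext {f g : Gam p q k →* H} (hS : f (S p q k) = g (S p q k))
    (hU : f (U p q k) = g (U p q k)) : f = g := by
  have h : f.eqLocus g = ⊤ := eq_top_of_S_U_mem hS hU
  refine MonoidHom.ext fun x => ?_
  have hx : x ∈ f.eqLocus g := h ▸ Subgroup.mem_top _
  exact hx

/-- Under the map to `ℤ` with `a ↦ q`, `b ↦ p`, this element goes to `k p q`, which is positive. -/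
theorem a_pow_ne_one (hp : 0 < p) (hq : 0 < q) (hk : 0 < k) : a p q ^ (k * p) ≠ 1 := by
  intro h
  have h' := congrArg (knotLift (p := p) (q := q) (Multiplicative.ofAdd (q : ℤ))
    (Multiplicative.ofAdd (p : ℤ)) (by
      rw [← ofAdd_nsmul, ← ofAdd_nsmul, nsmul_eq_mul, nsmul_eq_mul, mul_comm (p : ℤ)])) h
  rw [map_pow, knotLift_a, map_one, ← ofAdd_nsmul, ofAdd_eq_one, nsmul_eq_mul] at h'
  have : 0 < k * p * q := by positivity
  have h0 : ((k * p * q : ℕ) : ℤ) = 0 := by exact_mod_cast h'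
  omega

/-- The homomorphism `Γ_k → ℤ/kpq` with `S ↦ q` and `U ↦ p`. -/
def toCyclic (p q k : ℕ) : Gam p q k →* Multiplicative (ZMod (k * p * q)) :=
  gamLift (Multiplicative.ofAdd (q : ZMod (k * p * q))) (Multiplicative.ofAdd (p : ZMod _))
    (by rw [← ofAdd_nsmul, ← ofAdd_nsmul, nsmul_eq_mul, nsmul_eq_mul]; exact congrArg Multiplicative.ofAdd (mul_comm _ _))
    (by
      rw [← ofAdd_nsmul, ofAdd_eq_one, nsmul_eq_mul]
      exact_mod_cast ZMod.natCast_self (k * p * q))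

/-- The relations bound the order above by `k p`; the image `q` of `S` in `ℤ/kpq` already has that
order. -/
theorem orderOf_S (hp : 0 < p) (hq : 0 < q) (hk : 0 < k) : orderOf (S p q k) = k * p := by
  rw [orderOf_eq_iff (by positivity)]
  refine ⟨S_pow_mul p q k, fun m hm hm0 h => ?_⟩
  have h' := congrArg (toCyclic p q k) h
  rw [map_pow, toCyclic, gamLift_S, map_one, ← ofAdd_nsmul, ofAdd_eq_one, nsmul_eq_mul,
    ← Nat.cast_mul, ZMod.natCast_eq_zero_iff] at h'
  exact absurd (Nat.le_of_dvd hm0 (Nat.dvd_of_mul_dvd_mul_right hq h')) (by omega)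

theorem orderOf_U (hp : 0 < p) (hq : 0 < q) (hk : 0 < k) : orderOf (U p q k) = k * q := by
  rw [orderOf_eq_iff (by positivity)]
  refine ⟨U_pow_mul p q k, fun m hm hm0 h => ?_⟩
  have h' := congrArg (toCyclic p q k) h
  rw [map_pow, toCyclic, gamLift_U, map_one, ← ofAdd_nsmul, ofAdd_eq_one, nsmul_eq_mul,
    ← Nat.cast_mul, ZMod.natCast_eq_zero_iff, mul_right_comm] at h'
  exact absurd (Nat.le_of_dvd hm0 (Nat.dvd_of_mul_dvd_mul_right hp h')) (by omega)

theorem exists_equiv_presented (p q k : ℕ) : ∃ e : Gam p q k ≃* Presented p q k,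
    e (S p q k) = PresentedGroup.of 0 ∧ e (U p q k) = PresentedGroup.of 1 := by
  have h1 : (PresentedGroup.of 0 : Presented p q k) ^ (k * p) = 1 :=
    PresentedGroup.one_of_mem (x := FreeGroup.of 0 ^ (k * p)) (by simp)
  have h2 : (PresentedGroup.of 0 : Presented p q k) ^ p = PresentedGroup.of 1 ^ q :=
    PresentedGroup.mk_eq_mk_of_mul_inv_mem (x := FreeGroup.of 0 ^ p) (y := FreeGroup.of 1 ^ q)
      (by simp)
  let f : Gam p q k →* Presented p q k := gamLift _ _ h2 h1
  let g : Presented p q k →* Gam p q k :=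
    PresentedGroup.toGroup (f := ![S p q k, U p q k]) (by
      rintro r (rfl | rfl | rfl)
      · simp [S_pow_mul]
      · simp [U_pow_mul]
      · simp [S_pow_eq])
  have g0 : g (PresentedGroup.of 0) = S p q k := PresentedGroup.toGroup.of _
  have g1 : g (PresentedGroup.of 1) = U p q k := PresentedGroup.toGroup.of _
  have f0 : f (S p q k) = PresentedGroup.of 0 := gamLift_S _ _ _ _
  have f1 : f (U p q k) = PresentedGroup.of 1 := gamLift_U _ _ _ _
  refine ⟨f.toMulEquiv g (gam_hom_ext (by simp [f0, g0]) (by simp [f1, g1])) ?_, f0, f1⟩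
  refine PresentedGroup.ext fun x => ?_
  fin_cases x
  · simp [f0, g0]
  · simp [f1, g1]

/-- The homomorphism from `ℤ/n` sending the generator to `h`. -/
def cyclicLift (n : ℕ) (h : H) (hn : h ^ n = 1) : Multiplicative (ZMod n) →* H :=
  AddMonoidHom.toMultiplicativeLeft
    (ZMod.lift n ⟨zmultiplesHom (Additive H) (Additive.ofMul h), by
      simpa [← ofMul_pow] using hn⟩)

@[simp]
theorem cyclicLift_gen (n : ℕ) (h : H) (hn : h ^ n = 1) :
    cyclicLift n h hn (Multiplicative.ofAdd 1) = h := by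
  have h1 := ZMod.lift_coe n ⟨zmultiplesHom (Additive H) (Additive.ofMul h), by
      simpa [← ofMul_pow] using hn⟩ 1
  simp only [Int.cast_one] at h1
  simp [cyclicLift, h1]

theorem cyclic_hom_ext {n : ℕ} {f g : Multiplicative (ZMod n) →* H}
    (h : f (Multiplicative.ofAdd 1) = g (Multiplicative.ofAdd 1)) : f = g := by
  refine MonoidHom.ext fun x => ?_
  obtain ⟨m, hm⟩ := ZMod.intCast_surjective (Multiplicative.toAdd x)
  have hx : x = Multiplicative.ofAdd (1 : ZMod n) ^ m := by
    rw [← ofAdd_zsmul, zsmul_one, hm, ofAdd_toAdd]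
  rw [hx, map_zpow, map_zpow, h]

theorem exists_equiv_amalgam (p q k : ℕ) : ∃ e : Gam p q k ≃* Amalgam p q k,
    e (S p q k) = Monoid.PushoutI.of (φ := fun i => cyclicInclusion k (![p, q] i))
      (0 : Fin 2) (Multiplicative.ofAdd 1) ∧
    e (U p q k) = Monoid.PushoutI.of (φ := fun i => cyclicInclusion k (![p, q] i))
      (1 : Fin 2) (Multiplicative.ofAdd 1) := by
  let t : ∀ i : Fin 2, Amalgam p q k := fun i =>
    Monoid.PushoutI.of (φ := fun i => cyclicInclusion k (![p, q] i)) i (Multiplicative.ofAdd 1)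
  -- Both powers are the image of the generator of the amalgamated `ℤ/k`; this gives the relation `S
  -- ^ p = U ^ q` and also kills its `k`-th power.
  have hb : ∀ i, t i ^ (![p, q] i) = Monoid.PushoutI.base
      (fun i : Fin 2 => cyclicInclusion k (![p, q] i)) (Multiplicative.ofAdd 1) := fun i => by
    rw [← Monoid.PushoutI.of_apply_eq_base _ i, cyclicInclusion_gen, map_pow]
  have h1 : t 0 ^ (k * p) = 1 := by
    rw [mul_comm, pow_mul]
    refine (congrArg (· ^ k) (hb 0)).trans ?_
    rw [← map_pow, ← ofAdd_nsmul, nsmul_one, ZMod.natCast_self, ofAdd_zero, map_one]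
  have h2 : t 0 ^ p = t 1 ^ q := (hb 0).trans (hb 1).symm
  let f : Gam p q k →* Amalgam p q k := gamLift _ _ h2 h1
  have hg : ∀ i, (![S p q k, U p q k] i) ^ (k * ![p, q] i) = 1 := fun i => by
    fin_cases i
    · exact S_pow_mul p q k
    · exact U_pow_mul p q k
  have hk : (S p q k ^ p) ^ k = 1 := by rw [← pow_mul, mul_comm, S_pow_mul]
  let g : Amalgam p q k →* Gam p q k :=
    Monoid.PushoutI.lift (fun i => cyclicLift _ (![S p q k, U p q k] i) (hg i))
      (cyclicLift k (S p q k ^ p) hk) (fun i => cyclic_hom_ext (by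
        rw [MonoidHom.comp_apply, cyclicInclusion_gen, map_pow, cyclicLift_gen, cyclicLift_gen]
        fin_cases i
        · rfl
        · exact (S_pow_eq p q k).symm))
  have hgt : ∀ i, g (t i) = ![S p q k, U p q k] i := fun i =>
    (Monoid.PushoutI.lift_of _ _ _ _).trans (cyclicLift_gen _ _ _)
  have f0 : f (S p q k) = t 0 := gamLift_S _ _ _ _
  have f1 : f (U p q k) = t 1 := gamLift_U _ _ _ _
  refine ⟨f.toMulEquiv g (gam_hom_ext ?_ ?_) ?_, f0, f1⟩
  · rw [MonoidHom.comp_apply, f0]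
    exact hgt 0
  · rw [MonoidHom.comp_apply, f1]
    exact hgt 1
  · refine Monoid.PushoutI.hom_ext_nonempty fun i => cyclic_hom_ext ?_
    have h : f (g (t i)) = t i := by
      rw [hgt]
      fin_cases i
      · exact f0
      · exact f1
    exact h

end GroupHoms

/-! ### The group ring over the group ring of a finite cyclic subgroup -/

section CyclicSubgroups

variable {Γ : Type} [Group Γ]

theorem el_one : (el (1 : Γ) : MonoidAlgebra ℤ Γ) = 1 := map_one _

theorem el_mul (g h : Γ) : (el (g * h) : MonoidAlgebra ℤ Γ) = el g * el h := map_mul _ _ _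

theorem el_pow (g : Γ) (n : ℕ) : (el (g ^ n) : MonoidAlgebra ℤ Γ) = el g ^ n := map_pow _ _ _

/-- The additive extension to the group ring of a function on the group. -/
noncomputable def extend {M : Type} [AddCommGroup M] (f : Γ → M) : MonoidAlgebra ℤ Γ →+ M :=
  (Finsupp.liftAddHom fun g => zmultiplesHom M (f g)).comp
    MonoidAlgebra.coeffAddEquiv.toAddMonoidHom

@[simp]
theorem extend_el {M : Type} [AddCommGroup M] (f : Γ → M) (g : Γ) : extend f (el g) = f g := by
  simp [extend, el, MonoidAlgebra.of_apply]

theorem groupRing_addHom_ext {M : Type} [AddCommGroup M] {f f' : MonoidAlgebra ℤ Γ →+ M}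
    (h : ∀ g, f (el g) = f' (el g)) : f = f' := by
  refine MonoidAlgebra.addMonoidHom_ext fun g n => ?_
  have hs : MonoidAlgebra.single g n = n • (el g : MonoidAlgebra ℤ Γ) := by
    simp [el, MonoidAlgebra.of_apply]
  rw [hs, map_zsmul, map_zsmul, h]

theorem normSum_eq_geom_sum (g : Γ) {n : ℕ} (hn : 0 < n) :
    normSum g (n - 1) = ∑ i ∈ Finset.range n, (el g) ^ i := by
  rw [normSum, Nat.sub_add_cancel hn]
  exact Finset.sum_congr rfl fun i _ => map_pow _ _ _

/-- A representative of the coset `g ⟨h⟩`. -/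
noncomputable def cosetRep (h g : Γ) : Γ :=
  (QuotientGroup.mk g : Γ ⧸ Subgroup.zpowers h).out

theorem cosetRep_mul_pow (h g : Γ) (i : ℕ) : cosetRep h (g * h ^ i) = cosetRep h g := by
  have : (QuotientGroup.mk (g * h ^ i) : Γ ⧸ Subgroup.zpowers h) = QuotientGroup.mk g := by
    rw [eq_comm, QuotientGroup.eq]
    simp
  rw [cosetRep, this, cosetRep]

theorem cosetRep_idem (h g : Γ) : cosetRep h (cosetRep h g) = cosetRep h g := by
  simp [cosetRep]

theorem exists_cosetRep_mul_pow {h : Γ} {n : ℕ} (hn : 0 < n) (ho : orderOf h = n) (g : Γ) :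
    ∃ i < n, cosetRep h g * h ^ i = g := by
  classical
  have h1 : (cosetRep h g)⁻¹ * g ∈ Subgroup.zpowers h := by
    rw [← QuotientGroup.eq]
    simp [cosetRep]
  rw [(orderOf_pos_iff.mp (ho ▸ hn)).mem_zpowers_iff_mem_range_orderOf, ho] at h1
  obtain ⟨i, hi, h2⟩ := Finset.mem_image.mp h1
  exact ⟨i, Finset.mem_range.mp hi, by rw [h2, mul_inv_cancel_left]⟩

open Classical in
/-- The restriction of an element of the group ring to the coset representatives. -/
noncomputable def restrictRep (h : Γ) : MonoidAlgebra ℤ Γ →+ MonoidAlgebra ℤ Γ :=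
  extend fun g => if cosetRep h g = g then el g else 0

theorem cosetRep_mul_pow_eq_self_iff {h : Γ} {n : ℕ} (ho : orderOf h = n) (g : Γ) {i : ℕ}
    (hi : i < n) : cosetRep h (cosetRep h g * h ^ i) = cosetRep h g * h ^ i ↔ i = 0 := by
  rw [cosetRep_mul_pow, cosetRep_idem, eq_comm, mul_eq_left]
  constructor
  · intro h1
    by_contra h0
    exact absurd (Nat.le_of_dvd (Nat.pos_of_ne_zero h0) (orderOf_dvd_of_pow_eq_one h1)) (by omega)
  · rintro rfl
    exact pow_zero h

theorem el_pow_mul_geom_sum {h : Γ} {n : ℕ} (ho : orderOf h = n) (i : ℕ) :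
    (el h : MonoidAlgebra ℤ Γ) ^ i * ∑ j ∈ Finset.range n, (el h) ^ j =
      ∑ j ∈ Finset.range n, (el h) ^ j := by
  have h0 : ((el h : MonoidAlgebra ℤ Γ) - 1) * ∑ j ∈ Finset.range n, (el h) ^ j = 0 := by
    rw [mul_geom_sum, ← map_pow, ← ho, pow_orderOf_eq_one, map_one, sub_self]
  rw [sub_mul, one_mul, sub_eq_zero] at h0
  induction i with
  | zero => simp
  | succ i ih => rw [pow_succ, mul_assoc, h0, ih]

theorem el_mul_geom_sum {h : Γ} {n : ℕ} (hn : 0 < n) (ho : orderOf h = n) (g : Γ) :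
    (el g : MonoidAlgebra ℤ Γ) * ∑ j ∈ Finset.range n, (el h) ^ j =
      ∑ j ∈ Finset.range n, el (cosetRep h g * h ^ j) := by
  obtain ⟨i, -, hg⟩ := exists_cosetRep_mul_pow hn ho g
  conv_lhs => rw [← hg, el, map_mul, map_pow, mul_assoc, el_pow_mul_geom_sum ho]
  simp only [el, map_mul, map_pow, Finset.mul_sum]

/-- Multiplying by the norm spreads `g` evenly over its coset `g ⟨h⟩`, and exactly one element of
that coset is the chosen representative. -/
theorem restrictRep_el_mul_geom_sum {h : Γ} {n : ℕ} (hn : 0 < n) (ho : orderOf h = n) (g : Γ) :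
    restrictRep h (el g * ∑ j ∈ Finset.range n, (el h) ^ j) = el (cosetRep h g) := by
  rw [el_mul_geom_sum hn ho, map_sum, Finset.sum_eq_single_of_mem 0 (Finset.mem_range.mpr hn)]
  · rw [pow_zero, mul_one, restrictRep, extend_el, if_pos (cosetRep_idem h g)]
  · intro i hi h0
    rw [restrictRep, extend_el,
      if_neg ((cosetRep_mul_pow_eq_self_iff ho g (Finset.mem_range.mp hi)).not.mpr h0)]

theorem exists_eq_mul_sub_one {h : Γ} {n : ℕ} (hn : 0 < n) (ho : orderOf h = n)
    {x : MonoidAlgebra ℤ Γ} (hx : x * ∑ j ∈ Finset.range n, (el h) ^ j = 0) :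
    ∃ y, x = y * (el h - 1) := by
  choose i _ hi using exists_cosetRep_mul_pow hn ho
  -- A contracting homotopy, checked on group elements: if `g = r h ^ i` with `r` the
  -- representative, then `g = r + r (1 + ⋯ + h ^ (i - 1)) (h - 1)`, and `r` is recovered from `g`
  -- times the norm. The first term therefore vanishes at `x`.
  have h1 : AddMonoidHom.id (MonoidAlgebra ℤ Γ) =
      (restrictRep h).comp (AddMonoidHom.mulRight (∑ j ∈ Finset.range n, (el h) ^ j)) +
      (AddMonoidHom.mulRight (el h - 1)).comp
        (extend fun g => el (cosetRep h g) * ∑ j ∈ Finset.range (i g), (el h) ^ j) := by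
    refine groupRing_addHom_ext fun g => ?_
    simp only [AddMonoidHom.id_apply, AddMonoidHom.add_apply, AddMonoidHom.comp_apply,
      AddMonoidHom.mulRight_apply, restrictRep_el_mul_geom_sum hn ho, extend_el, mul_assoc,
      geom_sum_mul]
    rw [mul_sub, mul_one, ← map_pow, ← map_mul, hi]
    abel
  have h2 := DFunLike.congr_fun h1 x
  simp only [AddMonoidHom.id_apply, AddMonoidHom.add_apply, AddMonoidHom.comp_apply,
    AddMonoidHom.mulRight_apply, hx, map_zero, zero_add] at h2
  exact ⟨_, h2⟩

theorem exists_eq_mul_geom_sum {h : Γ} {n : ℕ} (hn : 0 < n) (ho : orderOf h = n)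
    {x : MonoidAlgebra ℤ Γ} (hx : x * (el h - 1) = 0) :
    ∃ y, x = y * ∑ j ∈ Finset.range n, (el h) ^ j := by
  -- The decomposition of the group ring into translates by `h ^ j` of the span of the
  -- representatives. For `x` fixed by `h` all components agree, so `x` is one component times the
  -- norm.
  have h1 : AddMonoidHom.id (MonoidAlgebra ℤ Γ) = ∑ j ∈ Finset.range n,
      (AddMonoidHom.mulRight ((el h) ^ j)).comp
        ((restrictRep h).comp (AddMonoidHom.mulRight (el (h ^ j)⁻¹))) := by
    refine groupRing_addHom_ext fun g => ?_
    obtain ⟨i, hin, hi⟩ := exists_cosetRep_mul_pow hn ho g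
    simp only [AddMonoidHom.id_apply, AddMonoidHom.finsetSum_apply, AddMonoidHom.comp_apply,
      AddMonoidHom.mulRight_apply]
    have hrep : ∀ j, cosetRep h (g * (h ^ j)⁻¹) = cosetRep h g := fun j => by
      rw [← cosetRep_mul_pow h _ j, inv_mul_cancel_right]
    rw [Finset.sum_eq_single_of_mem i (Finset.mem_range.mpr hin)]
    · rw [← map_mul, restrictRep, extend_el, if_pos, ← map_pow, ← map_mul, inv_mul_cancel_right]
      rw [hrep, eq_mul_inv_iff_mul_eq, hi]
    · intro j hj hji
      rw [← map_mul, restrictRep, extend_el, if_neg, zero_mul]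
      rw [hrep, eq_mul_inv_iff_mul_eq]
      intro hj'
      refine hji (pow_injOn_Iio_orderOf ?_ ?_ (mul_left_cancel (hj'.trans hi.symm)))
      · simpa [ho] using hj
      · simpa [ho] using hin
  have hx' : ∀ j, x * el (h ^ j)⁻¹ = x := fun j => by
    have h2 : x * el (h ^ j) = x := by
      have h3 := congrArg (x * ·) (mul_geom_sum (el h : MonoidAlgebra ℤ Γ) j)
      simp only [← mul_assoc, hx, zero_mul, mul_sub, mul_one] at h3
      rw [el, map_pow]
      exact (sub_eq_zero.mp h3.symm)
    conv_lhs => rw [← h2]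
    rw [mul_assoc, ← map_mul, mul_inv_cancel, map_one, mul_one]
  have h2 := DFunLike.congr_fun h1 x
  simp only [AddMonoidHom.id_apply, AddMonoidHom.finsetSum_apply, AddMonoidHom.comp_apply,
    AddMonoidHom.mulRight_apply, hx', ← Finset.mul_sum] at h2
  exact ⟨_, h2⟩

end CyclicSubgroups

/-! ### Invariance of the rank and periodicity -/

section StableRank

/-- A matrix identity `x * y = 1` over `A` is carried entrywise to one over `B`, where it bounds the
sizes. -/
theorem rankCondition_of_ringHom {A B : Type*} [Ring A] [Ring B] (f : A →+* B) [RankCondition B] :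
    RankCondition A := by
  rw [rankCondition_iff_matrix]
  intro n m x y h
  refine rankCondition_iff_matrix.mp (inferInstanceAs (RankCondition B)) n m (x.map f) (y.map f) ?_
  rw [← Matrix.map_mul, h, Matrix.map_one _ (map_zero f) (map_one f)]

/-- The augmentation of the integral group ring, as a homomorphism of rings. -/
noncomputable def augmentationRingHom (Γ : Type) [Group Γ] : MonoidAlgebra ℤ Γ →+* ℤ :=
  (MonoidAlgebra.lift ℤ ℤ Γ 1).toRingHom

theorem hasStableRankFrom_freeRank (Γ : Type) [Group Γ] :
    HasStableRankFrom (MonoidAlgebra ℤ Γ) 1 freeRank 2 := by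
  rintro (_ | n) hn
  · omega
  · refine ⟨rfl, fun ι B => ?_⟩
    have := rankCondition_of_ringHom (augmentationRingHom Γ)
    have h := mk_eq_mk_of_basis' B (Pi.basisFun (MonoidAlgebra ℤ Γ) (Fin 2))
    rw [Nat.card, h, ← Nat.card, Nat.card_fin]

theorem isTwoPeriodicFrom_differential (p q k : ℕ) :
    IsTwoPeriodicFrom 1 freeRank (differential p q k) := by
  rintro (_ | n) hn
  · omega
  · refine ⟨rfl, rfl, ?_⟩
    have h : Even (n + 2) ↔ Even n := by simp [Nat.even_add]
    change (if Even (n + 2) then del2 p q k else del3 p q k) =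
      (if Even n then del2 p q k else del3 p q k)
    simp only [h]

end StableRank

/-! ### The augmentation ideal and crossed homomorphisms -/

section Derivation

variable {p q k : ℕ}

theorem augmentation_eq_zero_iff {Γ : Type} [Group Γ] (x : MonoidAlgebra ℤ Γ) :
    augmentation Γ x = 0 ↔ extend (fun _ => (1 : ℤ)) x = 0 := by
  have h : ((Representation.trivial ℤ Γ ℤ).asModuleEquiv.toAddMonoidHom.comp
      (augmentation Γ).toAddMonoidHom) = extend (fun _ : Γ => (1 : ℤ)) := by
    refine groupRing_addHom_ext fun g => ?_
    rw [extend_el]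
    exact augmentation_single g 1
  rw [← h]
  exact ((Representation.trivial ℤ Γ ℤ).asModuleEquiv.map_eq_zero_iff).symm

/-- The left ideal generated by `S - 1` and `U - 1` contains every `g - 1`. -/
theorem exists_el_sub_one_eq (g : Gam p q k) :
    ∃ x y : GroupRing p q k, el g - 1 = x * (el (S p q k) - 1) + y * (el (U p q k) - 1) := by
  let K : Subgroup (Gam p q k) :=
    { carrier := {g | ∃ x y : GroupRing p q k,
        el g - 1 = x * (el (S p q k) - 1) + y * (el (U p q k) - 1)}
      one_mem' := ⟨0, 0, by rw [el_one]; noncomm_ring⟩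
      mul_mem' := by
        rintro g h ⟨x, y, hg⟩ ⟨x', y', hh⟩
        refine ⟨el g * x' + x, el g * y' + y, ?_⟩
        have e : (el (g * h) : GroupRing p q k) - 1 = el g * (el h - 1) + (el g - 1) := by
          rw [el_mul]; noncomm_ring
        rw [e, hh, hg]; noncomm_ring
      inv_mem' := by
        rintro g ⟨x, y, hg⟩
        refine ⟨-(el g⁻¹ * x), -(el g⁻¹ * y), ?_⟩
        have e : (el g⁻¹ : GroupRing p q k) - 1 = -(el g⁻¹ * (el g - 1)) := by
          rw [mul_sub, ← el_mul, inv_mul_cancel, el_one]; noncomm_ring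
        rw [e, hg]; noncomm_ring }
  have hK : K = ⊤ := eq_top_of_S_U_mem ⟨1, 0, by simp⟩ ⟨0, 1, by simp⟩
  exact (hK ▸ Subgroup.mem_top g : g ∈ K)

theorem exists_eq_of_augmentation_eq_zero {x : GroupRing p q k}
    (hx : augmentation (Gam p q k) x = 0) :
    ∃ y z, x = y * (el (S p q k) - 1) + z * (el (U p q k) - 1) := by
  rw [augmentation_eq_zero_iff] at hx
  choose c d hcd using exists_el_sub_one_eq (p := p) (q := q) (k := k)
  -- The additive extension of `g = (g - 1) + 1`, with `g - 1` written in the two generators; the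
  -- last term is the sum of the coefficients, which vanishes at `x`.
  have h : AddMonoidHom.id (GroupRing p q k) =
      (AddMonoidHom.mulRight (el (S p q k) - 1)).comp (extend c) +
      (AddMonoidHom.mulRight (el (U p q k) - 1)).comp (extend d) +
      ((Int.castRingHom (GroupRing p q k)).toAddMonoidHom).comp (extend fun _ => (1 : ℤ)) := by
    refine groupRing_addHom_ext fun g => ?_
    simp only [AddMonoidHom.id_apply, AddMonoidHom.add_apply, AddMonoidHom.comp_apply,
      AddMonoidHom.mulRight_apply, extend_el, ← hcd]
    simp
  have h2 := DFunLike.congr_fun h x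
  simp only [AddMonoidHom.id_apply, AddMonoidHom.add_apply, AddMonoidHom.comp_apply,
    AddMonoidHom.mulRight_apply, hx, map_zero, add_zero] at h2
  exact ⟨_, _, h2⟩

/-- The action of a group by left multiplication on a module over its group ring. -/
noncomputable def elPerm {Γ M : Type} [Group Γ] [AddCommGroup M] [Module (MonoidAlgebra ℤ Γ) M] :
    Γ →* Equiv.Perm M where
  toFun g :=
    { toFun := fun m => (el g : MonoidAlgebra ℤ Γ) • m
      invFun := fun m => (el g⁻¹ : MonoidAlgebra ℤ Γ) • m
      left_inv := fun m => by
        simp only [smul_smul, ← el_mul, inv_mul_cancel, el_one, one_smul]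
      right_inv := fun m => by
        simp only [smul_smul, ← el_mul, mul_inv_cancel, el_one, one_smul] }
  map_one' := Equiv.ext fun m => by
    change (el (1 : Γ) : MonoidAlgebra ℤ Γ) • m = m
    rw [el_one, one_smul]
  map_mul' g h := Equiv.ext fun m => by
    change (el (g * h) : MonoidAlgebra ℤ Γ) • m = (el g : MonoidAlgebra ℤ Γ) • _
    rw [el_mul, mul_smul]
    rfl

/-- For an element `e` of a module with `S ^ p • e = e` there is a crossed homomorphism which
sends `S` to `(S - 1) • e` and `U` to `0`. -/
theorem exists_crossedHom {M : Type} [AddCommGroup M] [Module (GroupRing p q k) M] (e : M)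
    (he : (el (S p q k ^ p) : GroupRing p q k) • e = e) :
    ∃ d : Gam p q k → M,
      (∀ g h, d (g * h) = (el g : GroupRing p q k) • d h + d g) ∧
      d (S p q k) = (el (S p q k) - 1 : GroupRing p q k) • e ∧ d (U p q k) = 0 := by
  let σ : Gam p q k →* Equiv.Perm M := elPerm
  have hσ : ∀ g m, σ g m = (el g : GroupRing p q k) • m := fun _ _ => rfl
  let t : Equiv.Perm M := Equiv.addRight e
  have ht : ∀ m, t m = m + e := fun _ => rfl
  -- Translation by `e` commutes with the action of `S ^ p` because `S ^ p` fixes `e`. Conjugating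
  -- the action of `S` alone by this translation thus leaves its `p`-th power unchanged, and both
  -- relations of `Γ_k` survive.
  have hcomm : Commute t (σ (S p q k ^ p)) := by
    ext m
    rw [Equiv.Perm.mul_apply, Equiv.Perm.mul_apply, ht, hσ, hσ, ht, smul_add, he]
  have h1 : (t⁻¹ * σ (S p q k) * t⁻¹⁻¹) ^ p = σ (U p q k) ^ q := by
    rw [conj_pow, ← map_pow, ← map_pow, ← S_pow_eq, inv_inv, mul_assoc, ← hcomm.eq,
      inv_mul_cancel_left]
  have h2 : (t⁻¹ * σ (S p q k) * t⁻¹⁻¹) ^ (k * p) = 1 := by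
    rw [conj_pow, ← map_pow, S_pow_mul, map_one, mul_one, mul_inv_cancel]
  let ρ : Gam p q k →* Equiv.Perm M := gamLift _ _ h1 h2
  have hS : ∀ m, ρ (S p q k) m = (el (S p q k) : GroupRing p q k) • (m + e) - e := fun m => by
    rw [gamLift_S, inv_inv, Equiv.Perm.mul_apply, Equiv.Perm.mul_apply, ht, hσ,
      Equiv.Perm.inv_eq_iff_eq, ht, sub_add_cancel]
  have hU : ∀ m, ρ (U p q k) m = (el (U p q k) : GroupRing p q k) • m := fun m => by
    rw [gamLift_U]
    rfl
  -- The elements acting through `ρ` by affine maps with linear part `g`. They form a subgroup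
  -- containing `S` and `U`; the translation part `ρ g 0` is then the crossed homomorphism.
  let K : Subgroup (Gam p q k) :=
    { carrier := {g | ∀ m, ρ g m = (el g : GroupRing p q k) • m + ρ g 0}
      one_mem' := fun m => by
        rw [map_one, Equiv.Perm.one_apply, Equiv.Perm.one_apply, el_one, one_smul, add_zero]
      mul_mem' := by
        intro g h hg hh m
        rw [map_mul, Equiv.Perm.mul_apply, Equiv.Perm.mul_apply, hh, hg, hg (ρ h 0), el_mul,
          smul_add, smul_smul, add_assoc]
      inv_mem' := by
        intro g hg m
        have h0 := hg (ρ g⁻¹ 0)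
        apply (ρ g).injective
        rw [hg ((el g⁻¹ : GroupRing p q k) • m + ρ g⁻¹ 0), smul_add, add_assoc, ← h0,
          ← Equiv.Perm.mul_apply, ← Equiv.Perm.mul_apply, ← map_mul, mul_inv_cancel, map_one,
          smul_smul, ← el_mul, mul_inv_cancel, el_one, one_smul, Equiv.Perm.one_apply,
          Equiv.Perm.one_apply, add_zero] }
  have hK : K = ⊤ := eq_top_of_S_U_mem
    (fun m => by rw [hS, hS, zero_add, smul_add, add_sub_assoc])
    (fun m => by rw [hU, hU, smul_zero, add_zero])
  have hρ : ∀ g m, ρ g m = (el g : GroupRing p q k) • m + ρ g 0 := fun g =>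
    (hK ▸ Subgroup.mem_top g : g ∈ K)
  refine ⟨fun g => ρ g 0, fun g h => ?_, ?_, ?_⟩
  · simp only
    rw [map_mul, Equiv.Perm.mul_apply, hρ]
  · simp only
    rw [hS, zero_add, sub_smul, one_smul]
  · simp only
    rw [hU, smul_zero]

/-- Modulo the left ideal of `S ^ p - 1`, the class of `1` is fixed by `S ^ p`, so some crossed
homomorphism sends `S` to the class of `S - 1` and `U` to `0`. Applied to the relation, it leaves
only the class of `x (S - 1)`, which must therefore vanish. -/
theorem exists_mul_S_sub_one_eq {x y : GroupRing p q k}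
    (h : x * (el (S p q k) - 1) + y * (el (U p q k) - 1) = 0) :
    ∃ z, x * (el (S p q k) - 1) = z * (el (S p q k) ^ p - 1) := by
  let I : Submodule (GroupRing p q k) (GroupRing p q k) :=
    Submodule.span _ {el (S p q k) ^ p - 1}
  obtain ⟨d, hd, hdS, hdU⟩ := exists_crossedHom (p := p) (q := q) (k := k) (M := GroupRing p q k ⧸ I)
    (I.mkQ 1) (by
      rw [← map_smul, ← sub_eq_zero, ← map_sub, smul_eq_mul, mul_one, el_pow,
        Submodule.mkQ_apply, Submodule.Quotient.mk_eq_zero]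
      exact Submodule.mem_span_singleton_self _)
  -- The crossed homomorphism rule `d (h g) - d h = h • d g`, extended additively in `h`.
  have hD : ∀ (g : Gam p q k) (x : GroupRing p q k),
      extend d (x * (el g - 1)) = x • d g := by
    intro g x
    have e : (extend d).comp (AddMonoidHom.mulRight (el g - 1)) =
        (LinearMap.toSpanSingleton (GroupRing p q k) _ (d g)).toAddMonoidHom := by
      refine groupRing_addHom_ext fun h => ?_
      change extend d (el h * (el g - 1)) = (el h : GroupRing p q k) • d g
      rw [mul_sub, mul_one, ← el_mul, map_sub, extend_el, extend_el, hd, add_sub_cancel_right]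
    exact DFunLike.congr_fun e x
  have h1 := congrArg (extend d) h
  rw [map_add, map_zero, hD, hD, hdS, hdU, smul_zero, add_zero, smul_smul, ← map_smul,
    smul_eq_mul, mul_one, Submodule.mkQ_apply, Submodule.Quotient.mk_eq_zero,
    Submodule.mem_span_singleton] at h1
  obtain ⟨z, hz⟩ := h1
  exact ⟨z, hz.symm⟩

end Derivation

/-! ### Exactness of the resolution -/

section Exactness

/-- Every exponent below `n * m` is uniquely `m * j + i` with `i < m` and `j < n`. -/
theorem geom_sum_mul_geom_sum {A : Type*} [Ring A] (x : A) (m n : ℕ) :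
    (∑ j ∈ Finset.range n, (x ^ m) ^ j) * ∑ i ∈ Finset.range m, x ^ i =
      ∑ i ∈ Finset.range (n * m), x ^ i := by
  induction n with
  | zero => simp
  | succ n ih =>
    rw [Finset.sum_range_succ, add_mul, ih, add_mul, one_mul, Finset.sum_range_add,
      Finset.mul_sum, ← pow_mul]
    simp only [← pow_add, mul_comm m n]

variable {p q k : ℕ}

theorem rowMap_del1 (x : Fin 2 → GroupRing p q k) :
    rowMap (del1 p q k) x = ![x 0 * (el (S p q k) - 1) + x 1 * (el (U p q k) - 1)] := by
  rw [rowMap, Matrix.toLinearMapRight'_apply]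
  ext1 i
  fin_cases i
  simp [del1, Matrix.vecMul, dotProduct, Fin.sum_univ_two]

theorem rowMap_del2 (hp : 0 < p) (hq : 0 < q) (hk : 0 < k) (x : Fin 2 → GroupRing p q k) :
    rowMap (del2 p q k) x =
      ![x 0 * (∑ i ∈ Finset.range (k * p), el (S p q k) ^ i) +
          x 1 * (∑ i ∈ Finset.range p, el (S p q k) ^ i),
        -(x 1 * ∑ i ∈ Finset.range q, el (U p q k) ^ i)] := by
  rw [rowMap, Matrix.toLinearMapRight'_apply, ← normSum_eq_geom_sum _ hp,
    ← normSum_eq_geom_sum _ hq, ← normSum_eq_geom_sum _ (Nat.mul_pos hk hp)]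
  ext1 i
  fin_cases i <;> simp [del2, Matrix.vecMul, dotProduct, Fin.sum_univ_two]

theorem rowMap_del3 (hk : 0 < k) (x : Fin 2 → GroupRing p q k) :
    rowMap (del3 p q k) x =
      ![x 0 * (el (S p q k) - 1) + x 1 * (el (U p q k) - 1),
        x 1 * ((1 - el (U p q k)) * ∑ i ∈ Finset.range k, (el (U p q k) ^ q) ^ i)] := by
  rw [rowMap, Matrix.toLinearMapRight'_apply, ← el_pow, ← normSum_eq_geom_sum _ hk]
  ext1 i
  fin_cases i <;> simp [del3, Matrix.vecMul, dotProduct, Fin.sum_univ_two]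

theorem el_S_pow_eq (p q k : ℕ) :
    (el (S p q k) ^ p : GroupRing p q k) = el (U p q k) ^ q := by
  rw [← el_pow, S_pow_eq, el_pow]

theorem geom_sum_S_mul (p q k : ℕ) :
    (∑ i ∈ Finset.range (k * p), (el (S p q k) : GroupRing p q k) ^ i) *
      (el (S p q k) - 1) = 0 := by
  rw [geom_sum_mul, ← el_pow, S_pow_mul, el_one, sub_self]

theorem sub_one_mul_geom_sum_S (p q k : ℕ) :
    (el (S p q k) - 1) *
      (∑ i ∈ Finset.range (k * p), (el (S p q k) : GroupRing p q k) ^ i) = 0 := by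
  rw [mul_geom_sum, ← el_pow, S_pow_mul, el_one, sub_self]

theorem sub_one_mul_geom_sum_U (p q k : ℕ) :
    (el (U p q k) - 1) *
      (∑ i ∈ Finset.range (k * q), (el (U p q k) : GroupRing p q k) ^ i) = 0 := by
  rw [mul_geom_sum, ← el_pow, U_pow_mul, el_one, sub_self]

theorem exact_augmentationRow_del1 (p q k : ℕ) :
    Function.Exact (rowMap (del1 p q k)) (augmentationRow (Gam p q k)) := by
  have hel : ∀ (y : GroupRing p q k) (g : Gam p q k),
      augmentation (Gam p q k) (y * (el g - 1)) = 0 := fun y g => by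
    have h : augmentation (Gam p q k) (el g - 1) = 0 := by
      rw [augmentation_eq_zero_iff, map_sub, ← el_one, extend_el, extend_el, sub_self]
    exact (map_smul (augmentation (Gam p q k)) y _).trans (by rw [h, smul_zero])
  intro x
  constructor
  · intro hx
    obtain ⟨y, z, h⟩ := exists_eq_of_augmentation_eq_zero (x := x 0) hx
    refine ⟨![y, z], ?_⟩
    rw [rowMap_del1]
    ext1 i
    rw [Subsingleton.elim i 0]
    exact h.symm
  · rintro ⟨y, rfl⟩
    rw [rowMap_del1]
    change augmentation (Gam p q k) (y 0 * (el (S p q k) - 1) + y 1 * (el (U p q k) - 1)) = 0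
    rw [map_add, hel, hel, add_zero]

theorem exists_of_mul_sub_one_add_eq_zero (hp : 0 < p) (hq : 0 < q) (hk : 0 < k)
    {x y : GroupRing p q k}
    (h : x * (el (S p q k) - 1) + y * (el (U p q k) - 1) = 0) :
    ∃ w z, x = w * (∑ i ∈ Finset.range (k * p), el (S p q k) ^ i) +
        z * (∑ i ∈ Finset.range p, el (S p q k) ^ i) ∧
      y = -(z * ∑ i ∈ Finset.range q, el (U p q k) ^ i) := by
  obtain ⟨z, hz⟩ := exists_mul_S_sub_one_eq h
  have h1 : (x - z * ∑ i ∈ Finset.range p, el (S p q k) ^ i) * (el (S p q k) - 1) = 0 := by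
    rw [sub_mul, mul_assoc, geom_sum_mul, hz, sub_self]
  have h2 : (y + z * ∑ i ∈ Finset.range q, el (U p q k) ^ i) * (el (U p q k) - 1) = 0 := by
    rw [add_mul, mul_assoc, geom_sum_mul, ← el_S_pow_eq, ← hz, add_comm, h]
  obtain ⟨w, hw⟩ := exists_eq_mul_geom_sum (Nat.mul_pos hk hp) (orderOf_S hp hq hk) h1
  obtain ⟨v, hv⟩ := exists_eq_mul_geom_sum (Nat.mul_pos hk hq) (orderOf_U hp hq hk) h2
  -- The remainder of `y` is `v` times the full norm of `U`, so the factorization of norms absorbs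
  -- it into `z`. As `U ^ q = S ^ p`, this change subtracts `v` times the full norm of `S` from the
  -- first coordinate; the summand `v` in `v + w` restores it.
  refine ⟨v + w, z - v * ∑ j ∈ Finset.range k, (el (U p q k) ^ q) ^ j, ?_, ?_⟩
  · rw [add_mul, sub_mul, mul_assoc v, ← el_S_pow_eq, geom_sum_mul_geom_sum, ← hw]
    abel
  · rw [sub_mul, mul_assoc v, geom_sum_mul_geom_sum, ← hv]
    abel

theorem exact_del1_del2 (hp : 0 < p) (hq : 0 < q) (hk : 0 < k) :
    Function.Exact (rowMap (del2 p q k)) (rowMap (del1 p q k)) := by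
  intro x
  constructor
  · intro hx
    rw [rowMap_del1] at hx
    obtain ⟨w, z, h0, h1⟩ := exists_of_mul_sub_one_add_eq_zero hp hq hk (congrFun hx 0)
    refine ⟨![w, z], ?_⟩
    rw [rowMap_del2 hp hq hk]
    ext1 i
    fin_cases i
    · exact h0.symm
    · exact h1.symm
  · rintro ⟨y, rfl⟩
    rw [rowMap_del1, rowMap_del2 hp hq hk]
    ext1 i
    rw [Subsingleton.elim i 0]
    simp only [Matrix.cons_val_zero, Matrix.cons_val_one, Pi.zero_apply]
    rw [add_mul, mul_assoc, geom_sum_S_mul, mul_assoc, geom_sum_mul, neg_mul, mul_assoc,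
      geom_sum_mul, el_S_pow_eq]
    simp

/-- The first column of `∂₃` is `∂₁`, so its kernel lies in the image of `∂₂` by exactness in degree
1. The second column kills that image since the product of norms telescopes to `1 - U ^ (k q) = 0`.
-/
theorem exact_del3_del2 (hp : 0 < p) (hq : 0 < q) (hk : 0 < k) :
    Function.Exact (rowMap (del2 p q k)) (rowMap (del3 p q k)) := by
  intro x
  have hdel : ∀ x, rowMap (del3 p q k) x 0 = rowMap (del1 p q k) x 0 := fun x => by
    rw [rowMap_del3 hk, rowMap_del1]
    rfl
  constructor
  · intro hx
    refine (exact_del1_del2 hp hq hk x).mp ?_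
    ext1 i
    rw [Subsingleton.elim i 0, ← hdel, hx]
    rfl
  · rintro ⟨y, rfl⟩
    ext1 i
    fin_cases i
    · exact (hdel _).trans (congrFun
        ((exact_del1_del2 hp hq hk _).mpr ⟨y, rfl⟩) 0)
    · change rowMap (del3 p q k) _ 1 = 0
      rw [rowMap_del3 hk, rowMap_del2 hp hq hk]
      simp only [Matrix.cons_val_one, Matrix.cons_val_fin_one]
      have h : (∑ i ∈ Finset.range q, el (U p q k) ^ i) * (1 - el (U p q k)) =
          -((el (U p q k) : GroupRing p q k) ^ q - 1) := by
        rw [geom_sum_mul_neg, neg_sub]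
      rw [neg_mul, mul_assoc, ← mul_assoc (∑ i ∈ Finset.range q, el (U p q k) ^ i), h, neg_mul,
        mul_geom_sum, ← pow_mul, mul_comm q k, ← el_pow, U_pow_mul, el_one]
      simp

theorem exact_del2_del3 (hp : 0 < p) (hq : 0 < q) (hk : 0 < k) :
    Function.Exact (rowMap (del3 p q k)) (rowMap (del2 p q k)) := by
  have hUk : orderOf (U p q k ^ q) = k := by
    rw [orderOf_pow_of_dvd hq.ne', orderOf_U hp hq hk, Nat.mul_div_cancel _ hq]
    rw [orderOf_U hp hq hk]
    exact dvd_mul_left q k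
  -- Because `U ^ q = S ^ p`, the norm of `U ^ q` combines with the partial sum in `S` to give the
  -- full norm of `S`.
  have hNS : ∀ v : GroupRing p q k,
      v * ((1 - el (U p q k)) * ∑ i ∈ Finset.range k, (el (U p q k) ^ q) ^ i) *
        (∑ i ∈ Finset.range p, el (S p q k) ^ i) =
      -(v * (el (U p q k) - 1) * ∑ i ∈ Finset.range (k * p), el (S p q k) ^ i) := fun v => by
    rw [mul_assoc, mul_assoc, ← el_S_pow_eq, geom_sum_mul_geom_sum, ← mul_assoc, ← neg_mul,
      ← mul_neg, neg_sub]
  intro x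
  constructor
  · intro hx
    rw [rowMap_del2 hp hq hk] at hx
    have hx0 := congrFun hx 0
    have hx1 := congrFun hx 1
    simp only [Matrix.cons_val_zero, Matrix.cons_val_one, Pi.zero_apply, neg_eq_zero] at hx0 hx1
    -- The cyclic lemma is used twice: for `U ^ q`, of order `k`, to write `x 1 = t N` with `N` its
    -- norm, and then for `U`, of order `k q`, since `t` is killed by the full norm of `U`.
    have h1 : x 1 * (el (U p q k ^ q) - 1) = 0 := by
      rw [el_pow, ← geom_sum_mul, ← mul_assoc, hx1, zero_mul]
    obtain ⟨t, ht⟩ := exists_eq_mul_geom_sum hk hUk h1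
    rw [ht, el_pow, mul_assoc, geom_sum_mul_geom_sum] at hx1
    obtain ⟨v, hv⟩ := exists_eq_mul_sub_one (Nat.mul_pos hk hq) (orderOf_U hp hq hk) hx1
    have hy : x 1 = (-v) * ((1 - el (U p q k)) *
        ∑ i ∈ Finset.range k, (el (U p q k) ^ q) ^ i) := by
      rw [ht, hv, el_pow, neg_mul, ← mul_neg, ← neg_mul, neg_sub, mul_assoc]
    -- With `x 1` known, the first coordinate says that `x 0 + v (U - 1)` is killed by the full norm
    -- of `S`, hence is a left multiple of `S - 1`.
    rw [hy, hNS, neg_mul, neg_mul, neg_neg, ← add_mul] at hx0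
    obtain ⟨w, hw⟩ := exists_eq_mul_sub_one (Nat.mul_pos hk hp) (orderOf_S hp hq hk) hx0
    refine ⟨![w, -v], ?_⟩
    rw [rowMap_del3 hk]
    ext1 i
    fin_cases i
    · simp only [Matrix.cons_val_zero, Matrix.cons_val_one, Fin.zero_eta]
      rw [← hw, neg_mul, add_neg_cancel_right]
    · exact hy.symm
  · rintro ⟨y, rfl⟩
    rw [rowMap_del2 hp hq hk, rowMap_del3 hk]
    ext1 i
    fin_cases i
    · simp only [Matrix.cons_val_zero, Matrix.cons_val_one, Fin.zero_eta, Pi.zero_apply]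
      rw [hNS, add_mul, mul_assoc (y 0), sub_one_mul_geom_sum_S, mul_zero, zero_add,
        add_neg_cancel]
    · simp only [Matrix.cons_val_one, Matrix.cons_val_fin_one, Fin.mk_one, Pi.zero_apply]
      rw [neg_eq_zero, mul_assoc, mul_assoc, geom_sum_mul_geom_sum, ← neg_sub, neg_mul,
        sub_one_mul_geom_sum_U, neg_zero, mul_zero]

theorem isFreeResolution_differential (hp : 0 < p) (hq : 0 < q) (hk : 0 < k) :
    IsFreeResolution freeRank (differential p q k) (augmentationRow (Gam p q k)) where
  surjective n := by
    refine ⟨fun _ => MonoidAlgebra.single 1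
        ((Representation.trivial ℤ (Gam p q k) ℤ).asModuleEquiv n),
      (Representation.trivial ℤ (Gam p q k) ℤ).asModuleEquiv.injective ?_⟩
    exact augmentation_single _ _
  exact_zero := exact_augmentationRow_del1 p q k
  exact_succ n := by
    rcases n with _ | n
    · exact exact_del1_del2 hp hq hk
    · change Function.Exact (rowMap (if Even (n + 1) then del2 p q k else del3 p q k))
        (rowMap (if Even n then del2 p q k else del3 p q k))
      by_cases h : Even n
      · rw [if_pos h, if_neg (by rwa [Nat.even_add_one, not_not])]
        exact exact_del2_del3 hp hq hk
      · rw [if_neg h, if_pos (Nat.even_add_one.mpr h)]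
        exact exact_del3_del2 hp hq hk

end Exactness

end TorusKnot

theorem mainTheorem3 (p q k : ℕ) (hp : 0 < p) (hq : 0 < q) (hk : 0 < k)
    (hpq : Nat.gcd p q = 1) :
    -- the element `a ^ (k p)` is central and nontrivial in the torus knot group
    (TorusKnot.a p q ^ (k * p) ≠ 1 ∧
      TorusKnot.a p q ^ (k * p) ∈ Subgroup.center (TorusKnot.KnotGroup p q)) ∧
    -- the quotient `Γ_k` has the stated presentation
    (∃ e : TorusKnot.Gam p q k ≃* TorusKnot.Presented p q k,
      e (TorusKnot.S p q k) = PresentedGroup.of 0 ∧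
      e (TorusKnot.U p q k) = PresentedGroup.of 1) ∧
    -- the quotient `Γ_k` is the amalgamated product of two cyclic groups
    (∃ e : TorusKnot.Gam p q k ≃* TorusKnot.Amalgam p q k,
      e (TorusKnot.S p q k) =
        Monoid.PushoutI.of (φ := fun i => TorusKnot.cyclicInclusion k (![p, q] i))
          (0 : Fin 2) (Multiplicative.ofAdd 1) ∧
      e (TorusKnot.U p q k) =
        Monoid.PushoutI.of (φ := fun i => TorusKnot.cyclicInclusion k (![p, q] i))
          (1 : Fin 2) (Multiplicative.ofAdd 1)) ∧
    -- the explicit free resolution of the trivial module, its periodicity and its stable rank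
    TorusKnot.IsFreeResolution TorusKnot.freeRank (TorusKnot.differential p q k)
      (TorusKnot.augmentationRow (TorusKnot.Gam p q k)) ∧
    TorusKnot.IsTwoPeriodicFrom 1 TorusKnot.freeRank (TorusKnot.differential p q k) ∧
    TorusKnot.HasStableRankFrom (TorusKnot.GroupRing p q k) 1 TorusKnot.freeRank 2 := by
  exact ⟨⟨TorusKnot.a_pow_ne_one hp hq hk, TorusKnot.a_pow_mem_center p q k⟩,
    TorusKnot.exists_equiv_presented p q k, TorusKnot.exists_equiv_amalgam p q k,
    TorusKnot.isFreeResolution_differential hp hq hk,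
    TorusKnot.isTwoPeriodicFrom_differential p q k,
    TorusKnot.hasStableRankFrom_freeRank (TorusKnot.Gam p q k)⟩
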